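/- For an ideal $I$ of a Noetherian ring $S$ and $m\ge 1$ let $$I^{(m)}=\bigcap_{\mathfrak p\in\operatorname{Ass}(S/I)}\bigl(I^mS_{\mathfrak p}\cap S\bigr)$$ be the $m$-th symbolic power of $I$, where $I^mS_{\mathfrak p}\cap S$ is the preimage of $I^mS_{\mathfrak p}$ under $S\to S_{\mathfrak p}$, and let $$\rho(I)=\sup\Bigl\{\tfrac mr \;:\; m\ge 1,\ r\ge 1,\ I^{(m)}\not\subseteq I^r\Bigr\}\in[0,\infty]$$ be the resurgence of $I$. **Theorem.** Let $k$ be an algebraically closed field, let $A$ and $B$ be finitely generated ($\mathbb N$-graded) $k$-algebras which are integral domains, and let $I\subset A$ and $J\subset B$ be nonzero proper homogeneous ideals. Put $R=A\otimes_k B$ and write $I+J$ for the ideal $IR+JR$ of $R$. Then $$\max\{\rho(I),\rho(J)\}\;\le\;\rho(I+J)\;\le\;\max\Bigl\{\rho(I),\,\rho(J),\,\tfrac{2(\rho(I)+\rho(J))}{3}\Bigr\}.$$ Moreover, if $\max\{\rho(I),\rho(J)\}\ge 2\min\{\rho(I),\rho(J)\}$, then $\rho(I+J)=\max\{\rho(I),\rho(J)\}$.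 -/

import Mathlib

open scoped ENNReal TensorProduct

noncomputable section

/-- The `m`-th symbolic power `I^(m) = ⋂_{p ∈ Ass(R/I)} (I^m R_p ∩ R)` of an ideal `I`,
where `p` runs over all associated primes of `R ⧸ I` (embedded ones included). -/
def symbolicPower {R : Type*} [CommRing R] (I : Ideal R) (m : ℕ) : Ideal R :=
  ⨅ (p : PrimeSpectrum R) (_ : p.asIdeal ∈ associatedPrimes R (R ⧸ I)),
    ((I ^ m).map (algebraMap R (Localization.AtPrime p.asIdeal))).comap
      (algebraMap R (Localization.AtPrime p.asIdeal))

/-- The resurgence `ρ(I) = sup { m / r | m ≥ 1, r ≥ 1, I^(m) ⊄ I^r }`,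
a supremum in `[0, ∞]`. -/
def resurgence {R : Type*} [CommRing R] (I : Ideal R) : ℝ≥0∞ :=
  sSup {x : ℝ≥0∞ | ∃ m r : ℕ, 1 ≤ m ∧ 1 ≤ r ∧ ¬ symbolicPower I m ≤ I ^ r ∧
    x = (m : ℝ≥0∞) / (r : ℝ≥0∞)}

/-- The ideal `I + J := I R + J R` of `R = A ⊗[k] B`, for ideals `I` of `A` and `J` of `B`. -/
def tensorSum (k : Type*) {A B : Type*} [CommRing k] [CommRing A] [CommRing B]
    [Algebra k A] [Algebra k B] (I : Ideal A) (J : Ideal B) : Ideal (A ⊗[k] B) :=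
  I.map (Algebra.TensorProduct.includeLeft : A →ₐ[k] A ⊗[k] B) ⊔
    J.map (Algebra.TensorProduct.includeRight : B →ₐ[k] A ⊗[k] B)

end

/-! The symbolic power `I^(m)` consists of the `x` with `s * x ∈ I ^ m` for some `s` regular modulo
`I` (`mem_symbolicPower_iff`). Over an algebraically closed field `p + q` is prime when `p` and `q`
are, because tensor products of domains are domains. Hence an element regular modulo `I + J` stays
regular modulo `I^(i) + J^(j)`. Since `(I + J)^m ⊆ I^i + J^j` for `i + j ≤ m + 1`, also `(I + J)^(m)
⊆ I^(i) + J^(j)`.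

Conversely, `(I + J)^r` contains the intersection of the `I^t + J^u` with `t + u = r + 1` and `t, u
≥ 1`. A failure `(I + J)^(m) ⊄ (I + J)^r` therefore splits into failures `I^(i) ⊄ I^t` and `J^(j) ⊄
J^u` with `i + j = m` and `t + u = r + 1` (`exists_not_le_of_symbolicPower_tensorSum`), so `m ≤ ρ(I)
t + ρ(J) u`. If `i, j ≥ 1` then `t, u ≥ 2`, and the worst case `t = u = 2`, `r = 3` produces the
constant 2/3. The lower bound comes from `x ↦ x ⊗ 1`, which carries failures for `I` to failures for
`I + J`. -/

/-! ### Tensor products of domains -/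

/-- A nonzero element of a finitely generated domain over an algebraically closed field does not
vanish at some rational point. -/
theorem exists_algHom_apply_ne_zero {k B : Type*} [Field k] [IsAlgClosed k] [CommRing B]
    [IsDomain B] [Algebra k B] [Algebra.FiniteType k B] {b : B} (hb : b ≠ 0) :
    ∃ χ : B →ₐ[k] k, χ b ≠ 0 := by
  let L := Localization.Away b
  have : Nontrivial L :=
    (IsLocalization.injective L (powers_le_nonZeroDivisors_of_noZeroDivisors hb)).nontrivial
  have : Algebra.FiniteType B L := IsLocalization.finiteType_of_monoid_fg (Submonoid.powers b) L
  have : Algebra.FiniteType k L := Algebra.FiniteType.trans (S := B) inferInstance inferInstance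
  obtain ⟨m, hm⟩ := Ideal.exists_maximal L
  let : Field (L ⧸ m) := Ideal.Quotient.field m
  have : Module.Finite k (L ⧸ m) := finite_of_finite_type_of_isJacobsonRing k (L ⧸ m)
  let f : L ⧸ m →ₐ[k] k := IsAlgClosed.lift
  let g : B →ₐ[k] L ⧸ m := (Ideal.Quotient.mkₐ k m).comp (IsScalarTower.toAlgHom k B L)
  refine ⟨f.comp g, ?_⟩
  have hu : IsUnit (algebraMap B L b) := IsLocalization.Away.algebraMap_isUnit b
  exact (hu.map ((f.comp (Ideal.Quotient.mkₐ k m)) : L →ₐ[k] k)).ne_zero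

theorem repr_rid_map_algHom {k A B κ : Type*} [DecidableEq κ] [Field k] [CommRing A] [Algebra k A] [CommRing B]
    [Algebra k B] (b : Module.Basis κ k A) (χ : B →ₐ[k] k) (x : A ⊗[k] B) (i : κ) :
    b.repr (Algebra.TensorProduct.rid k k A
      (Algebra.TensorProduct.map (AlgHom.id k A) χ x)) i =
      χ (TensorProduct.equivFinsuppOfBasisLeft b x i) := by
  induction x with
  | zero => simp
  | tmul a c => simp [mul_comm]
  | add x y hx hy => simp [hx, hy]

/-- A rational point of `B` at which a nonzero coordinate of `x` and one of `y` both survive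
specializes `x * y = 0` to a product of nonzero elements of the domain `A`. -/
theorem noZeroDivisors_tensorProduct_of_finiteType {k A B : Type*} [Field k] [IsAlgClosed k]
    [CommRing A] [IsDomain A] [Algebra k A] [CommRing B] [IsDomain B] [Algebra k B]
    [Algebra.FiniteType k B] : NoZeroDivisors (A ⊗[k] B) where
  eq_zero_or_eq_zero_of_mul_eq_zero {x y} hxy := by
    classical
    by_contra! h
    let b := Module.Basis.ofVectorSpace k A
    let e := TensorProduct.equivFinsuppOfBasisLeft (N := B) b
    obtain ⟨i, hi⟩ := Finsupp.ne_iff.1 (e.map_ne_zero_iff.2 h.1)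
    obtain ⟨j, hj⟩ := Finsupp.ne_iff.1 (e.map_ne_zero_iff.2 h.2)
    obtain ⟨χ, hχ⟩ := exists_algHom_apply_ne_zero (k := k) (mul_ne_zero hi hj)
    rw [map_mul] at hχ
    have h0 := congrArg (fun z ↦ Algebra.TensorProduct.rid k k A
      (Algebra.TensorProduct.map (AlgHom.id k A) χ z)) hxy
    simp only [map_mul, map_zero, mul_eq_zero] at h0
    rcases h0 with h0 | h0
    · exact left_ne_zero_of_mul hχ
        ((repr_rid_map_algHom b χ x i).symm.trans (by simp [h0]))
    · exact right_ne_zero_of_mul hχ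
        ((repr_rid_map_algHom b χ y j).symm.trans (by simp [h0]))

/-- The tensor product of two domains over an algebraically closed field has no zero divisors. -/
theorem noZeroDivisors_tensorProduct {k A B : Type*} [Field k] [IsAlgClosed k]
    [CommRing A] [IsDomain A] [Algebra k A] [CommRing B] [IsDomain B] [Algebra k B] :
    NoZeroDivisors (A ⊗[k] B) where
  eq_zero_or_eq_zero_of_mul_eq_zero {x y} hxy := by
    obtain ⟨C, hC, hx⟩ := exists_fg_and_mem_baseChange x
    obtain ⟨D, hD, hy⟩ := exists_fg_and_mem_baseChange y
    have : Algebra.FiniteType k ↥(C ⊔ D) := (C ⊔ D).fg_iff_finiteType.1 (hC.sup hD)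
    -- Both factors descend to a finitely generated subalgebra of `B`; flatness over `k` keeps the
    -- inclusion injective after tensoring.
    let f : A ⊗[k] ↥(C ⊔ D) →ₐ[k] A ⊗[k] B :=
      Algebra.TensorProduct.map (AlgHom.id k A) (C ⊔ D).val
    have hf : Function.Injective f :=
      Module.Flat.lTensor_preserves_injective_linearMap (M := A) (C ⊔ D).val.toLinearMap
        Subtype.val_injective
    have key (E : Subalgebra k B) (hE : E ≤ C ⊔ D) (z : A ⊗[k] B) (hz : z ∈ E.baseChange A) :
        ∃ w, f w = z := by
      obtain ⟨w, rfl⟩ := hz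
      refine ⟨Algebra.TensorProduct.map (AlgHom.id k A) (Subalgebra.inclusion hE) w, ?_⟩
      induction w with
      | zero => simp
      | tmul a c => rfl
      | add x y hx hy => simp [hx, hy]
    obtain ⟨x, rfl⟩ := key C le_sup_left _ hx
    obtain ⟨y, rfl⟩ := key D le_sup_right _ hy
    have := noZeroDivisors_tensorProduct_of_finiteType (k := k) (A := A) (B := ↥(C ⊔ D))
    rw [← map_mul, map_eq_zero_iff f hf, mul_eq_zero] at hxy
    exact hxy.imp (by rintro rfl; simp) (by rintro rfl; simp)

/-- A nonzero, torsion-free element of a module over a domain is detected by a linear map to the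
fraction field. -/
theorem exists_linearMap_fractionRing_ne_zero {D M : Type*} [CommRing D] [IsDomain D]
    [AddCommGroup M] [Module D M] {m : M} (hm : ∀ d : D, d • m = 0 → d = 0) :
    ∃ φ : M →ₗ[D] FractionRing D, φ m ≠ 0 := by
  let V := LocalizedModule (nonZeroDivisors D) M
  have hv : (LocalizedModule.mkLinearMap (nonZeroDivisors D) M m : V) ≠ 0 := by
    intro h
    obtain ⟨c, hc⟩ := (IsLocalizedModule.eq_zero_iff (nonZeroDivisors D) _).1 h
    exact nonZeroDivisors.coe_ne_zero c (hm _ hc)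
  obtain ⟨f, hf⟩ : ∃ f : Module.Dual (FractionRing D) V, f _ ≠ 0 := by
    by_contra! h
    exact hv ((Module.forall_dual_apply_eq_zero_iff (FractionRing D) _).1 h)
  exact ⟨(f.restrictScalars D).comp (LocalizedModule.mkLinearMap (nonZeroDivisors D) M), hf⟩

/-! ### Associated primes and tensor products of modules -/

section TensorAct

variable (k : Type*) {A B M N M' N' : Type*} [Field k] [CommRing A] [Algebra k A] [CommRing B]
  [Algebra k B] [AddCommGroup M] [Module k M] [Module A M] [IsScalarTower k A M]
  [AddCommGroup N] [Module k N] [Module B N] [IsScalarTower k B N]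
  [AddCommGroup M'] [Module k M'] [Module A M'] [IsScalarTower k A M']
  [AddCommGroup N'] [Module k N'] [Module B N'] [IsScalarTower k B N']

/-- The action of `A ⊗ B` on `M ⊗ N`, for an `A`-module `M` and a `B`-module `N`. -/
noncomputable def tensorAct : A ⊗[k] B →ₗ[k] M ⊗[k] N →ₗ[k] M ⊗[k] N :=
  TensorProduct.homTensorHomMap (.id k) M N M N ∘ₗ
    TensorProduct.map (Algebra.lsmul k k M).toLinearMap (Algebra.lsmul k k N).toLinearMap

variable {k}

@[simp]
theorem tensorAct_tmul (a : A) (b : B) (m : M) (n : N) :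
    tensorAct k (a ⊗ₜ[k] b) (m ⊗ₜ[k] n) = (a • m) ⊗ₜ[k] (b • n) := rfl

theorem tensorAct_map (f : M →ₗ[A] M') (g : N →ₗ[B] N') (s : A ⊗[k] B) (z : M ⊗[k] N) :
    tensorAct k s (TensorProduct.map (f.restrictScalars k) (g.restrictScalars k) z) =
      TensorProduct.map (f.restrictScalars k) (g.restrictScalars k) (tensorAct k s z) := by
  induction s with
  | zero => simp
  | add s t hs ht => simp [hs, ht]
  | tmul a b =>
    induction z with
    | zero => simp
    | add z w hz hw => simp [hz, hw]
    | tmul m n => simp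

theorem tensorAct_comm (s : A ⊗[k] B) (z : M ⊗[k] N) :
    tensorAct k (TensorProduct.comm k A B s) (TensorProduct.comm k M N z) =
      TensorProduct.comm k M N (tensorAct k s z) := by
  induction s with
  | zero => simp
  | add s t hs ht => simp [hs, ht]
  | tmul a b =>
    induction z with
    | zero => simp
    | add z w hz hw => simp only [map_add, hz, hw]
    | tmul m n => simp

theorem tensorAct_smul (a : A) (s : A ⊗[k] B) (z : M ⊗[k] N) :
    tensorAct k s (a • z) = a • tensorAct k s z := by
  induction s with
  | zero => simp
  | add s t hs ht => simp [hs, ht]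
  | tmul c b =>
    induction z with
    | zero => simp
    | add z w hz hw => simp only [map_add, smul_add, hz, hw]
    | tmul m n => simp [TensorProduct.smul_tmul', smul_smul, mul_comm]

theorem tensorAct_eq_mul {K L : Type*} [CommRing K] [Algebra k K] [Algebra A K]
    [IsScalarTower k A K] [CommRing L] [Algebra k L] [Algebra B L] [IsScalarTower k B L]
    (s : A ⊗[k] B) (z : K ⊗[k] L) :
    tensorAct k s z = Algebra.TensorProduct.map (IsScalarTower.toAlgHom k A K)
      (IsScalarTower.toAlgHom k B L) s * z := by
  induction s with
  | zero => simp
  | add s t hs ht => simp [hs, ht, add_mul]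
  | tmul c b =>
    induction z with
    | zero => simp
    | add z w hz hw => simp only [map_add, mul_add, hz, hw]
    | tmul m n => simp [Algebra.smul_def]

variable (M) in
/-- A nonzero element of `M ⊗ N` can be moved to a nonzero element of `Frac (A ⧸ p) ⊗ N` for
some associated prime `p` of `M`, compatibly with the action of `A ⊗ B`. -/
theorem exists_associatedPrime_fractionRing_tensor [IsNoetherianRing A] {z : M ⊗[k] N}
    (hz : z ≠ 0) :
    ∃ p ∈ associatedPrimes A M, ∃ z' : FractionRing (A ⧸ p) ⊗[k] N, z' ≠ 0 ∧
      ∀ s : A ⊗[k] B, tensorAct k s z = 0 → tensorAct k s z' = 0 := by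
  classical
  let 𝒞 := Module.Basis.ofVectorSpace k N
  let e := TensorProduct.equivFinsuppOfBasisRight (M := M) 𝒞
  let c := e z
  have hc : c ≠ 0 := e.map_ne_zero_iff.2 hz
  obtain ⟨p, hp, hcp⟩ := exists_le_isAssociatedPrime_of_isNoetherianRing A
    (⟨c, Submodule.mem_span_singleton_self c⟩ : Submodule.span A {c}) (by simpa using hc)
  obtain ⟨hpp, ⟨x, hx⟩, hpx⟩ := isAssociatedPrime_iff.1 hp
  obtain ⟨a, rfl⟩ := Submodule.mem_span_singleton.1 hx
  have hann (r : A) : r ∈ p ↔ ∀ i, r • a • c i = 0 := by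
    rw [hpx, Submodule.mem_colon_singleton]
    simp [Subtype.ext_iff, Finsupp.ext_iff]
  -- `p` is the annihilator of `a • c`, a finite intersection of annihilators of coordinates. Being
  -- prime, it contains one of them.
  obtain ⟨i, hi⟩ : ∃ i, ∀ r : A, r • a • c i = 0 → r ∈ p := by
    have hle : c.support.inf (fun i ↦ (⊥ : Submodule A M).colon {a • c i}) ≤ p := by
      intro r hr
      rw [hann]
      intro i
      by_cases hi : i ∈ c.support
      · simpa [Submodule.mem_colon_singleton] using (Submodule.mem_finsetInf.1 hr) i hi
      · simp [Finsupp.notMem_support_iff.1 hi]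
    obtain ⟨i, -, hi⟩ := (hpp.inf_le').1 hle
    exact ⟨i, fun r hr ↦ hi (by simpa [Submodule.mem_colon_singleton] using hr)⟩
  refine ⟨p, isAssociatedPrime_iff.2 ⟨hpp, a • c i, ?_⟩, ?_⟩
  · ext r
    rw [Submodule.mem_colon_singleton, Submodule.mem_bot]
    exact ⟨fun h ↦ (hann r).1 h i, hi r⟩
  -- The coordinates of `a • z` are killed by `p`, so `a • z` comes from `M₀ ⊗ N` with `M₀` an `A ⧸
  -- p`-module, where `a • c i` is torsion-free.
  let M₀ := Submodule.torsionBySet A M p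
  have hM (i) : a • c i ∈ M₀ :=
    (Submodule.mem_torsionBySet_iff _ _).2 fun r ↦ (hann r).1 r.2 i
  let : Module (A ⧸ p) M₀ := (Submodule.torsionBySet_isTorsionBySet (R := A) (M := M) p).module
  have : IsScalarTower A (A ⧸ p) M₀ :=
    (Submodule.torsionBySet_isTorsionBySet (R := A) (M := M) p).isScalarTower
  obtain ⟨φ, hφ⟩ := exists_linearMap_fractionRing_ne_zero (D := A ⧸ p) (M := M₀)
    (m := ⟨a • c i, hM i⟩) (by
      intro d hd
      obtain ⟨r, rfl⟩ := Ideal.Quotient.mk_surjective d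
      exact Ideal.Quotient.eq_zero_iff_mem.2 (hi r (congrArg Subtype.val hd)))
  let ψ : M₀ →ₗ[A] FractionRing (A ⧸ p) := φ.restrictScalars A
  let z₀ : M₀ ⊗[k] N := ∑ j ∈ c.support, (⟨a • c j, hM j⟩ : M₀) ⊗ₜ[k] 𝒞 j
  have hz₀ : TensorProduct.map (M₀.subtype.restrictScalars k)
      ((LinearMap.id : N →ₗ[B] N).restrictScalars k) z₀ = a • z := by
    have : z = c.sum fun i m ↦ m ⊗ₜ 𝒞 i := by
      rw [← TensorProduct.equivFinsuppOfBasisRight_symm_apply, LinearEquiv.symm_apply_apply]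
    rw [this]
    simp [z₀, Finsupp.sum, Finset.smul_sum, TensorProduct.smul_tmul']
  have hinj : Function.Injective (TensorProduct.map (M₀.subtype.restrictScalars k)
      ((LinearMap.id : N →ₗ[B] N).restrictScalars k)) :=
    Module.Flat.rTensor_preserves_injective_linearMap (M := N) (M₀.subtype.restrictScalars k)
      Subtype.val_injective
  refine ⟨TensorProduct.map (ψ.restrictScalars k)
      ((LinearMap.id : N →ₗ[B] N).restrictScalars k) z₀, ?_, fun s hs ↦ ?_⟩
  · intro h
    have := congrArg (fun w ↦ TensorProduct.equivFinsuppOfBasisRight 𝒞 w i) h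
    simp only [z₀, map_sum, TensorProduct.map_tmul, Finsupp.coe_finsetSum, Finset.sum_apply,
      TensorProduct.equivFinsuppOfBasisRight_apply_tmul_apply, map_zero, Finsupp.coe_zero,
      Pi.zero_apply, LinearMap.coe_restrictScalars, LinearMap.id_apply,
      Module.Basis.repr_self, Finsupp.single_apply, ite_smul, one_smul, zero_smul,
      Finset.sum_ite_eq'] at this
    split_ifs at this with hi'
    · exact hφ this
    · apply hφ
      have : (⟨a • c i, hM i⟩ : M₀) = 0 := by
        ext
        simp [Finsupp.notMem_support_iff.1 hi']
      rw [this, map_zero]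
  · rw [tensorAct_map]
    have : tensorAct k s z₀ = 0 := by
      apply hinj
      rw [← tensorAct_map, hz₀, tensorAct_smul, hs, smul_zero, map_zero]
    rw [this, map_zero]

end TensorAct

/-! ### Symbolic powers through regular elements -/

section SymbolicPower

variable {R : Type*} [CommRing R]

/-- Prime avoidance for the associated primes of `R ⧸ I`. -/
theorem exists_mem_regular_of_not_le_associatedPrimes [IsNoetherianRing R] {I K : Ideal R}
    (h : ∀ p ∈ associatedPrimes R (R ⧸ I), ¬ K ≤ p) :
    ∃ s ∈ K, ∀ y, s * y ∈ I → y ∈ I := by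
  by_contra! hK
  obtain ⟨p, hp, hle⟩ := (K.subset_union_prime_finite (associatedPrimes.finite R (R ⧸ I))
    (f := id) 0 0 fun _ h _ _ ↦ h.1).1 <| by
    simp_rw [id, biUnion_associatedPrimes_eq_compl_regular]
    intro s hs hreg
    obtain ⟨y, hy, hy'⟩ := hK s hs
    exact hy' ((isSMulRegular_quotient_iff_mem_of_smul_mem I s).1 hreg y hy)
  exact h p hp hle

theorem mem_associatedPrimes_quotient_iff [IsNoetherianRing R] {I p : Ideal R} :
    p ∈ associatedPrimes R (R ⧸ I) ↔ p.IsPrime ∧ ∃ x, ∀ a, a ∈ p ↔ a * x ∈ I := by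
  rw [AssociatedPrimes.mem_iff, isAssociatedPrime_iff]
  refine and_congr_right fun _ ↦ Ideal.Quotient.mk_surjective.exists.trans
    (exists_congr fun x ↦ SetLike.ext_iff.trans (forall_congr' fun a ↦ ?_))
  rw [Submodule.mem_colon_singleton, Submodule.mem_bot, ← Ideal.Quotient.eq_zero_iff_mem (I := I), map_mul]
  rfl

/-- Symbolic powers via nonzerodivisors modulo `I`. -/
theorem mem_symbolicPower_iff [IsNoetherianRing R] {I : Ideal R} {m : ℕ} {x : R} :
    x ∈ symbolicPower I m ↔ ∃ s, (∀ y, s * y ∈ I → y ∈ I) ∧ s * x ∈ I ^ m := by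
  simp only [symbolicPower, Submodule.mem_iInf, Ideal.mem_comap]
  constructor
  · intro h
    obtain ⟨s, hs, hs'⟩ := exists_mem_regular_of_not_le_associatedPrimes
      (I := I) (K := (I ^ m).colon {x}) (by
        intro p hp hle
        have := hp.isPrime
        obtain ⟨c, hc, hcx⟩ := (IsLocalization.algebraMap_mem_map_algebraMap_iff p.primeCompl
          (Localization.AtPrime p) (I ^ m) x).1 (h ⟨p, hp.isPrime⟩ hp)
        exact hc (hle (Submodule.mem_colon_singleton.2 hcx)))
    exact ⟨s, hs', Submodule.mem_colon_singleton.1 hs⟩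
  · rintro ⟨s, hs, hsx⟩ p hp
    refine (IsLocalization.algebraMap_mem_map_algebraMap_iff p.asIdeal.primeCompl
      (Localization.AtPrime p.asIdeal) (I ^ m) x).2 ⟨s, fun hsp ↦ ?_, hsx⟩
    obtain ⟨hpp, y, hy⟩ := mem_associatedPrimes_quotient_iff.1 hp
    refine hpp.ne_top ((Ideal.eq_top_iff_one _).2 ((hy 1).2 ?_))
    rw [one_mul]
    exact hs y ((hy s).1 hsp)

theorem pow_le_symbolicPower [IsNoetherianRing R] (I : Ideal R) (m : ℕ) :
    I ^ m ≤ symbolicPower I m :=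
  fun x hx ↦ mem_symbolicPower_iff.2 ⟨1, by simp, by simpa⟩

theorem symbolicPower_zero [IsNoetherianRing R] (I : Ideal R) : symbolicPower I 0 = ⊤ :=
  top_le_iff.1 (by simpa using pow_le_symbolicPower I 0)

theorem symbolicPower_le_self [IsNoetherianRing R] (I : Ideal R) {m : ℕ} (hm : m ≠ 0) :
    symbolicPower I m ≤ I := by
  intro x hx
  obtain ⟨s, hs, hsx⟩ := mem_symbolicPower_iff.1 hx
  exact hs x (Ideal.pow_le_self hm hsx)

/-- Every associated prime of a symbolic power of `I` is contained in an associated prime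
of `I`. -/
theorem exists_le_associatedPrimes_of_symbolicPower [IsNoetherianRing R] {I p : Ideal R} {m : ℕ}
    (hp : p ∈ associatedPrimes R (R ⧸ symbolicPower I m)) :
    ∃ x ∉ I, ∀ a ∈ p, a * x ∈ I := by
  obtain ⟨q, hq, hpq⟩ : ∃ q ∈ associatedPrimes R (R ⧸ I), p ≤ q := by
    by_contra! h
    -- Otherwise `p` contains an `s` regular modulo `I`; but such elements are also regular modulo
    -- `symbolicPower I m`.
    obtain ⟨s, hs, hreg⟩ := exists_mem_regular_of_not_le_associatedPrimes h
    obtain ⟨hpp, y, hy⟩ := mem_associatedPrimes_quotient_iff.1 hp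
    obtain ⟨t, ht, hty⟩ := mem_symbolicPower_iff.1 ((hy s).1 hs)
    refine hpp.ne_top ((Ideal.eq_top_iff_one _).2 ((hy 1).2 ?_))
    rw [one_mul, mem_symbolicPower_iff]
    exact ⟨t * s, fun z hz ↦ hreg z (ht _ (by rwa [← mul_assoc])), by rwa [mul_assoc]⟩
  obtain ⟨hqq, x, hx⟩ := mem_associatedPrimes_quotient_iff.1 hq
  exact ⟨x, fun h ↦ hqq.ne_top ((Ideal.eq_top_iff_one _).2 ((hx 1).2 (by rwa [one_mul]))),
    fun a ha ↦ (hx a).1 (hpq ha)⟩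

theorem div_le_resurgence {I : Ideal R} {m r : ℕ} (hm : m ≠ 0) (hr : r ≠ 0)
    (h : ¬ symbolicPower I m ≤ I ^ r) : (m : ℝ≥0∞) / r ≤ resurgence I :=
  le_sSup ⟨m, r, Nat.one_le_iff_ne_zero.2 hm, Nat.one_le_iff_ne_zero.2 hr, h, rfl⟩

theorem natCast_le_resurgence_mul {I : Ideal R} {m r : ℕ} (hm : m ≠ 0) (hr : r ≠ 0)
    (h : ¬ symbolicPower I m ≤ I ^ r) : (m : ℝ≥0∞) ≤ resurgence I * r :=
  (ENNReal.div_le_iff (by simpa) (by simp)).1 (div_le_resurgence hm hr h)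

end SymbolicPower

/-! ### Sums of ideals in the tensor product -/

section TensorSum

variable {k A B : Type*} [Field k] [CommRing A] [Algebra k A] [CommRing B] [Algebra k B]

theorem map_includeLeft_le {I : Ideal A} {S : Submodule k (A ⊗[k] B)}
    (h : ∀ a ∈ I, ∀ b, a ⊗ₜ b ∈ S) :
    (I.map (Algebra.TensorProduct.includeLeft : A →ₐ[k] A ⊗[k] B)).restrictScalars k ≤ S := by
  rw [Ideal.map_includeLeft_eq]
  rintro _ ⟨y, rfl⟩
  induction y with
  | zero => simp
  | add y z hy hz => rw [map_add]; exact S.add_mem hy hz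
  | tmul a b => exact h a a.2 b

theorem map_includeRight_le {J : Ideal B} {S : Submodule k (A ⊗[k] B)}
    (h : ∀ a, ∀ b ∈ J, a ⊗ₜ b ∈ S) :
    (J.map (Algebra.TensorProduct.includeRight : B →ₐ[k] A ⊗[k] B)).restrictScalars k ≤ S := by
  rw [Ideal.map_includeRight_eq]
  rintro _ ⟨y, rfl⟩
  induction y with
  | zero => simp
  | add y z hy hz => rw [map_add]; exact S.add_mem hy hz
  | tmul a b => exact h a b b.2

theorem tmul_mem_map_includeLeft {I : Ideal A} {a : A} (ha : a ∈ I) (b : B) :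
    a ⊗ₜ b ∈ I.map (Algebra.TensorProduct.includeLeft : A →ₐ[k] A ⊗[k] B) := by
  simpa using Ideal.mul_mem_right (1 ⊗ₜ[k] b) _ (Ideal.mem_map_of_mem
    (Algebra.TensorProduct.includeLeft : A →ₐ[k] A ⊗[k] B) ha)

theorem tmul_mem_map_includeRight {J : Ideal B} (a : A) {b : B} (hb : b ∈ J) :
    a ⊗ₜ b ∈ J.map (Algebra.TensorProduct.includeRight : B →ₐ[k] A ⊗[k] B) := by
  simpa using Ideal.mul_mem_left _ (a ⊗ₜ[k] 1) (Ideal.mem_map_of_mem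
    (Algebra.TensorProduct.includeRight : B →ₐ[k] A ⊗[k] B) hb)

theorem tensorSum_mono {I I' : Ideal A} {J J' : Ideal B} (hI : I ≤ I') (hJ : J ≤ J') :
    tensorSum k I J ≤ tensorSum k I' J' :=
  sup_le_sup (Ideal.map_mono hI) (Ideal.map_mono hJ)

theorem map_comm_tensorSum_le (I : Ideal A) (J : Ideal B) :
    (tensorSum k I J).map (Algebra.TensorProduct.comm k A B) ≤ tensorSum k J I := by
  rw [tensorSum, Ideal.map_sup, sup_le_iff]
  constructor <;> rw [Ideal.map_le_iff_le_comap, Ideal.map_le_iff_le_comap] <;> intro x hx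
  · exact Ideal.mem_sup_right (tmul_mem_map_includeRight 1 hx)
  · exact Ideal.mem_sup_left (tmul_mem_map_includeLeft hx 1)

theorem comm_mem_tensorSum_iff {I : Ideal A} {J : Ideal B} {x : A ⊗[k] B} :
    Algebra.TensorProduct.comm k A B x ∈ tensorSum k J I ↔ x ∈ tensorSum k I J := by
  refine ⟨fun h ↦ ?_, fun h ↦ map_comm_tensorSum_le I J (Ideal.mem_map_of_mem _ h)⟩
  have := map_comm_tensorSum_le J I
    (Ideal.mem_map_of_mem (Algebra.TensorProduct.comm k B A) h)
  rwa [← Algebra.TensorProduct.comm_symm, AlgEquiv.symm_apply_apply] at this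

/-- Functionals vanishing on `I` and `J` but not at `a` and `b` have a tensor product that kills `I
+ J` but not `a ⊗ b`. -/
theorem tmul_notMem_tensorSum {I : Ideal A} {J : Ideal B} {a : A} {b : B} (ha : a ∉ I)
    (hb : b ∉ J) : a ⊗ₜ b ∉ tensorSum k I J := by
  obtain ⟨α, hα, hαI⟩ := (I.restrictScalars k).exists_le_ker_of_notMem ha
  obtain ⟨β, hβ, hβJ⟩ := (J.restrictScalars k).exists_le_ker_of_notMem hb
  let f : A ⊗[k] B →ₗ[k] k := TensorProduct.lid k k ∘ₗ TensorProduct.map α β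
  intro h
  obtain ⟨x, hx, y, hy, hxy⟩ := Submodule.mem_sup.1 h
  have hfx : f x = 0 := map_includeLeft_le (S := LinearMap.ker f) (fun a ha b ↦ by
    have : α a = 0 := hαI ha
    simp [f, this]) hx
  have hfy : f y = 0 := map_includeRight_le (S := LinearMap.ker f) (fun a b hb ↦ by
    have : β b = 0 := hβJ hb
    simp [f, this]) hy
  have : f (a ⊗ₜ b) = 0 := by rw [← hxy, map_add, hfx, hfy, add_zero]
  simp [f, hα, hβ] at this

theorem map_inf_map_le_mul (I : Ideal A) (J : Ideal B) :
    I.map (Algebra.TensorProduct.includeLeft : A →ₐ[k] A ⊗[k] B) ⊓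
      J.map (Algebra.TensorProduct.includeRight : B →ₐ[k] A ⊗[k] B) ≤
    I.map (Algebra.TensorProduct.includeLeft : A →ₐ[k] A ⊗[k] B) *
      J.map (Algebra.TensorProduct.includeRight : B →ₐ[k] A ⊗[k] B) := by
  rintro x ⟨hI, hJ⟩
  -- A `k`-linear projection of `B` onto `J` induces a map fixing the extension of `J` and sending
  -- the extension of `I` into the product.
  obtain ⟨π, hπ⟩ := LinearMap.exists_extend (p := J.restrictScalars k) LinearMap.id
  let f : A ⊗[k] B →ₗ[k] A ⊗[k] B :=
    TensorProduct.map LinearMap.id ((J.restrictScalars k).subtype ∘ₗ π)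
  have hfx : f x = x := by
    refine map_includeRight_le (S := LinearMap.eqLocus f LinearMap.id) (fun a b hb ↦ ?_) hJ
    have : π b = ⟨b, hb⟩ := LinearMap.congr_fun hπ ⟨b, hb⟩
    simp [f, this]
  rw [← hfx]
  refine map_includeLeft_le (S := (Submodule.restrictScalars k (_ * _ : Ideal (A ⊗[k] B))).comap f)
    (fun a ha b ↦ ?_) hI
  have : f (a ⊗ₜ b) = a ⊗ₜ[k] 1 * 1 ⊗ₜ[k] (π b : B) := by simp [f]
  rw [Submodule.mem_comap, this]
  exact Ideal.mul_mem_mul (tmul_mem_map_includeLeft ha 1) (tmul_mem_map_includeRight 1 (π b).2)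

/-- An element lying in `I ^ t + J ^ (r + 1 - t)` for `1 ≤ t ≤ r` lies in `(I + J) ^ r`. -/
theorem mem_tensorSum_pow {I : Ideal A} {J : Ideal B} {r : ℕ} {x : A ⊗[k] B}
    (h : ∀ t u, t ≠ 0 → u ≠ 0 → t + u = r + 1 → x ∈ tensorSum k (I ^ t) (J ^ u)) :
    x ∈ tensorSum k I J ^ r := by
  let F (t : ℕ) := (I ^ t).map (Algebra.TensorProduct.includeLeft : A →ₐ[k] A ⊗[k] B)
  let G (u : ℕ) := (J ^ u).map (Algebra.TensorProduct.includeRight : B →ₐ[k] A ⊗[k] B)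
  have hFG (t u : ℕ) (htu : t + u = r) : F t * G u ≤ tensorSum k I J ^ r := by
    rw [← htu, pow_add]
    refine Ideal.mul_mono ?_ ?_
    · exact (Ideal.map_pow _ _ _).le.trans (Ideal.pow_right_mono le_sup_left _)
    · exact (Ideal.map_pow _ _ _).le.trans (Ideal.pow_right_mono le_sup_right _)
  have hF {t t' : ℕ} (htt : t ≤ t') : F t' ≤ F t := Ideal.map_mono (Ideal.pow_le_pow_right htt)
  have hG {u u' : ℕ} (huu : u ≤ u') : G u' ≤ G u := Ideal.map_mono (Ideal.pow_le_pow_right huu)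
  -- Modulo `(I + J) ^ r`, `x` is pushed into ever higher powers of `I`. The correction is kept in
  -- `G (r + 1 - c)`, so that `z - v` lies in `F c ⊓ G (r - c)`, which is contained in `F c * G (r -
  -- c)`.
  have key (c : ℕ) (hc : c ≤ r) :
      ∃ y ∈ tensorSum k I J ^ r ⊓ G (r + 1 - c), ∃ z ∈ F c, y + z = x := by
    induction c with
    | zero => exact ⟨0, zero_mem _, x, by simp [F, Ideal.one_eq_top, Ideal.map_top], zero_add x⟩
    | succ c ih =>
      obtain ⟨y, ⟨hy, hyG⟩, z, hz, rfl⟩ := ih (by omega)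
      obtain ⟨v, hv, w, hw, hvw⟩ :=
        Submodule.mem_sup.1 (h (c + 1) (r - c) (by omega) (by omega) (by omega))
      have hw' : z - v ∈ G (r - c) := by
        have : z - v = w - y := by rw [sub_eq_sub_iff_add_eq_add, add_comm w, hvw, add_comm]
        rw [this]
        exact sub_mem hw (hG (by omega) hyG)
      have hz' : z - v ∈ F c := sub_mem hz (hF (by omega) hv)
      refine ⟨y + (z - v), ⟨add_mem hy (hFG c (r - c) (by omega)
        (map_inf_map_le_mul _ _ ⟨hz', hw'⟩)), ?_⟩, v, hv, by ring⟩
      rw [show r + 1 - (c + 1) = r - c by omega]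
      exact add_mem (hG (by omega) hyG) hw'
  obtain ⟨y, ⟨hy, -⟩, z, hz, rfl⟩ := key r le_rfl
  refine add_mem hy (hFG r 0 (by omega) ?_)
  simpa [G, Ideal.one_eq_top, Ideal.map_top] using hz

/-- In each binomial term `I ^ i * J ^ (r - i)`, either `i ≥ t` or `r - i ≥ u`. -/
theorem tensorSum_pow_le {I : Ideal A} {J : Ideal B} {r t u : ℕ} (h : t + u ≤ r + 1) :
    tensorSum k I J ^ r ≤ tensorSum k (I ^ t) (J ^ u) := by
  rw [tensorSum, ← Ideal.add_eq_sup, add_pow]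
  simp only [Ideal.sum_eq_sup]
  refine Finset.sup_le fun i hi ↦ ?_
  refine Ideal.mul_le_left.trans ?_
  rw [← Ideal.map_pow, ← Ideal.map_pow]
  by_cases hti : t ≤ i
  · exact Ideal.mul_le_left.trans
      ((Ideal.map_mono (Ideal.pow_le_pow_right hti)).trans le_sup_left)
  · exact Ideal.mul_le_right.trans
      ((Ideal.map_mono (Ideal.pow_le_pow_right (by omega))).trans le_sup_right)

theorem ker_map_quotient_eq_tensorSum (I : Ideal A) (J : Ideal B) :
    RingHom.ker (Algebra.TensorProduct.map (Ideal.Quotient.mkₐ k I) (Ideal.Quotient.mkₐ k J)) =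
      tensorSum k I J := by
  have hI : RingHom.ker (Ideal.Quotient.mkₐ k I) = I := Ideal.mk_ker
  have hJ : RingHom.ker (Ideal.Quotient.mkₐ k J) = J := Ideal.mk_ker
  rw [Algebra.TensorProduct.map_ker _ _ (Ideal.Quotient.mkₐ_surjective k I)
    (Ideal.Quotient.mkₐ_surjective k J), hI, hJ, tensorSum]

/-- A regular element of `A` modulo `I` is regular in `A ⊗ B` modulo `I + J`. -/
theorem regular_includeLeft_tensorSum {I : Ideal A} (J : Ideal B) {s : A}
    (hs : ∀ y, s * y ∈ I → y ∈ I) (y : A ⊗[k] B)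
    (hy : s ⊗ₜ 1 * y ∈ tensorSum k I J) : y ∈ tensorSum k I J := by
  rw [← ker_map_quotient_eq_tensorSum, RingHom.mem_ker] at hy ⊢
  let f : A ⧸ I →ₗ[k] A ⧸ I := LinearMap.mulLeft k (Ideal.Quotient.mk I s)
  have hf : Function.Injective f := by
    rw [injective_iff_map_eq_zero]
    intro z hz
    obtain ⟨z, rfl⟩ := Ideal.Quotient.mk_surjective z
    rw [LinearMap.mulLeft_apply, ← map_mul, Ideal.Quotient.eq_zero_iff_mem] at hz
    exact Ideal.Quotient.eq_zero_iff_mem.2 (hs z hz)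
  have hf' := Module.Flat.rTensor_preserves_injective_linearMap (M := B ⧸ J) f hf
  apply hf'
  rw [map_zero, ← hy, map_mul]
  generalize Algebra.TensorProduct.map (Ideal.Quotient.mkₐ k I) (Ideal.Quotient.mkₐ k J) y = w
  induction w with
  | zero => simp
  | add w z hw hz => simp only [map_add, mul_add, hw, hz]
  | tmul a b => simp [f]

/-- Over an algebraically closed field, an element of `A ⊗ B` outside all the ideals `p + q`, for
`p` and `q` associated primes of `I` and `J`, is regular modulo `I + J`. -/
theorem regular_tensorSum_of_notMem_associatedPrimes [IsAlgClosed k] [IsNoetherianRing A]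
    [IsNoetherianRing B] {I : Ideal A} {J : Ideal B} {s : A ⊗[k] B}
    (hs : ∀ p ∈ associatedPrimes A (A ⧸ I), ∀ q ∈ associatedPrimes B (B ⧸ J),
      s ∉ tensorSum k p q) (y : A ⊗[k] B) (hy : s * y ∈ tensorSum k I J) :
    y ∈ tensorSum k I J := by
  rw [← ker_map_quotient_eq_tensorSum, RingHom.mem_ker] at hy ⊢
  set z := Algebra.TensorProduct.map (Ideal.Quotient.mkₐ k I) (Ideal.Quotient.mkₐ k J) y with hz
  by_contra hz0
  have hsz : tensorAct k s z = 0 := by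
    rw [tensorAct_eq_mul, ← hy, map_mul, hz]
    rfl
  -- The left factor is replaced by a fraction field, then after a swap the right one. The resulting
  -- ring is a domain, so the image of `s` in it vanishes.
  obtain ⟨p, hp, z₁, hz₁, h₁⟩ := exists_associatedPrime_fractionRing_tensor (A := A) (B := B) (A ⧸ I) hz0
  obtain ⟨q, hq, z₂, hz₂, h₂⟩ := exists_associatedPrime_fractionRing_tensor (A := B) (B := A) (B ⧸ J)
    ((TensorProduct.comm k (FractionRing (A ⧸ p)) (B ⧸ J)).map_ne_zero_iff.2 hz₁)
  have hpp : p.IsPrime := hp.isPrime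
  have hqp : q.IsPrime := hq.isPrime
  have h := h₂ (TensorProduct.comm k A B s) (by rw [tensorAct_comm, h₁ s hsz, map_zero])
  have := noZeroDivisors_tensorProduct (k := k) (A := FractionRing (B ⧸ q))
    (B := FractionRing (A ⧸ p))
  rw [tensorAct_eq_mul, mul_eq_zero, or_iff_left hz₂] at h
  refine hs p hp q hq (comm_mem_tensorSum_iff.1 ?_)
  rw [← ker_map_quotient_eq_tensorSum, RingHom.mem_ker]
  have hinj : Function.Injective (TensorProduct.map
      (IsScalarTower.toAlgHom k (B ⧸ q) (FractionRing (B ⧸ q))).toLinearMap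
      (IsScalarTower.toAlgHom k (A ⧸ p) (FractionRing (A ⧸ p))).toLinearMap) :=
    TensorProduct.map_injective_of_flat_flat _ _
      (IsFractionRing.injective (B ⧸ q) (FractionRing (B ⧸ q)))
      (IsFractionRing.injective (A ⧸ p) (FractionRing (A ⧸ p)))
  apply hinj
  rw [map_zero, ← h]
  change _ = Algebra.TensorProduct.map _ _ (Algebra.TensorProduct.comm k A B s)
  generalize Algebra.TensorProduct.comm k A B s = w
  induction w with
  | zero => simp
  | add w z hw hz => simp only [map_add, hw, hz]
  | tmul a b => rfl

/-- Regular elements modulo `I + J` stay regular modulo sums of symbolic powers. -/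
theorem regular_tensorSum_symbolicPower [IsAlgClosed k] [IsNoetherianRing A]
    [IsNoetherianRing B] {I : Ideal A} {J : Ideal B} {s : A ⊗[k] B}
    (hs : ∀ y, s * y ∈ tensorSum k I J → y ∈ tensorSum k I J) (i j : ℕ) (y : A ⊗[k] B)
    (hy : s * y ∈ tensorSum k (symbolicPower I i) (symbolicPower J j)) :
    y ∈ tensorSum k (symbolicPower I i) (symbolicPower J j) := by
  refine regular_tensorSum_of_notMem_associatedPrimes (fun p hp q hq hmem ↦ ?_) y hy
  obtain ⟨a, ha, hpa⟩ := exists_le_associatedPrimes_of_symbolicPower hp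
  obtain ⟨b, hb, hqb⟩ := exists_le_associatedPrimes_of_symbolicPower hq
  -- If `s ∈ p + q`, where `p` kills `a` modulo `I` and `q` kills `b` modulo `J`, then `s` kills `a
  -- ⊗ b` modulo `I + J`, against regularity.
  refine tmul_notMem_tensorSum ha hb (hs (a ⊗ₜ b) ?_)
  have hle : tensorSum k p q ≤ (tensorSum k I J).colon {a ⊗ₜ[k] b} := by
    refine sup_le ?_ ?_ <;> rw [Ideal.map_le_iff_le_comap] <;> intro c hc <;>
      rw [Ideal.mem_comap, Submodule.mem_colon_singleton, smul_eq_mul]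
    · simpa [tensorSum] using Ideal.mem_sup_left (tmul_mem_map_includeLeft (hpa c hc) b)
    · simpa [tensorSum] using Ideal.mem_sup_right (tmul_mem_map_includeRight a (hqb c hc))
  exact Submodule.mem_colon_singleton.1 (hle hmem)

end TensorSum

theorem two_le_of_not_symbolicPower_le_pow {R : Type*} [CommRing R] [IsNoetherianRing R]
    {K : Ideal R} {i t : ℕ} (hi : i ≠ 0) (ht : t ≠ 0) (h : ¬ symbolicPower K i ≤ K ^ t) :
    2 ≤ t := by
  by_contra! h2
  obtain rfl : t = 1 := by omega
  exact h (by simpa using symbolicPower_le_self K hi)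

/-! ### Bounds on the resurgence -/

section Resurgence

variable {k A B : Type*} [Field k] [CommRing A] [Algebra k A] [CommRing B] [Algebra k B]
  [IsNoetherianRing (A ⊗[k] B)]

theorem resurgence_le_resurgence_tensorSum_left [IsNoetherianRing A] (I : Ideal A) {J : Ideal B}
    (hJ : J ≠ ⊤) : resurgence I ≤ resurgence (tensorSum k I J) := by
  refine sSup_le ?_
  rintro _ ⟨m, r, hm, hr, hmr, rfl⟩
  refine div_le_resurgence (by omega) (by omega) fun h ↦ ?_
  obtain ⟨x, hx, hxr⟩ := SetLike.not_le_iff_exists.1 hmr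
  obtain ⟨s, hs, hsx⟩ := mem_symbolicPower_iff.1 hx
  have hx' : x ⊗ₜ 1 ∈ symbolicPower (tensorSum k I J) m := by
    refine mem_symbolicPower_iff.2 ⟨s ⊗ₜ 1, regular_includeLeft_tensorSum J hs, ?_⟩
    rw [Algebra.TensorProduct.tmul_mul_tmul, mul_one]
    refine Ideal.pow_right_mono le_sup_left m ?_
    rw [← Ideal.map_pow]
    exact tmul_mem_map_includeLeft hsx 1
  -- With `u = 1`: `(I + J) ^ r` lies in `I ^ r + J`, which excludes `x ⊗ 1`.
  have := tensorSum_pow_le (t := r) (u := 1) le_rfl (h hx')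
  rw [pow_one] at this
  exact tmul_notMem_tensorSum hxr (fun h1 ↦ hJ ((Ideal.eq_top_iff_one J).2 h1)) this

theorem symbolicPower_tensorSum_le_comap_comm [IsNoetherianRing (B ⊗[k] A)] (I : Ideal A)
    (J : Ideal B) (m : ℕ) : symbolicPower (tensorSum k I J) m ≤
      (symbolicPower (tensorSum k J I) m).comap (Algebra.TensorProduct.comm k A B) := by
  intro x hx
  obtain ⟨s, hs, hsx⟩ := mem_symbolicPower_iff.1 hx
  refine mem_symbolicPower_iff.2 ⟨Algebra.TensorProduct.comm k A B s, fun y hy ↦ ?_, ?_⟩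
  · obtain ⟨y, rfl⟩ := (Algebra.TensorProduct.comm k A B).surjective y
    rw [← map_mul, comm_mem_tensorSum_iff] at hy
    exact comm_mem_tensorSum_iff.2 (hs y hy)
  · rw [← map_mul]
    refine Ideal.pow_right_mono (map_comm_tensorSum_le I J) m ?_
    rw [← Ideal.map_pow]
    exact Ideal.mem_map_of_mem _ hsx

theorem resurgence_tensorSum_comm_le [IsNoetherianRing (B ⊗[k] A)] (I : Ideal A) (J : Ideal B) :
    resurgence (tensorSum k I J) ≤ resurgence (tensorSum k J I) := by
  refine sSup_le ?_
  rintro _ ⟨m, r, hm, hr, hmr, rfl⟩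
  refine div_le_resurgence (by omega) (by omega) fun h ↦ hmr fun x hx ↦ ?_
  have := Ideal.mem_map_of_mem (Algebra.TensorProduct.comm k B A)
    (h (symbolicPower_tensorSum_le_comap_comm I J m hx))
  rw [Ideal.map_pow] at this
  replace this := Ideal.pow_right_mono (map_comm_tensorSum_le J I) r this
  rwa [← Algebra.TensorProduct.comm_symm, AlgEquiv.symm_apply_apply] at this

/-- If `(I + J)^(m)` is not contained in `(I + J)^r`, this is explained by two noncontainments
`I^(i) ⊄ I^t` and `J^(j) ⊄ J^u` with `i + j = m` and `t + u = r + 1`. -/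
theorem exists_not_le_of_symbolicPower_tensorSum [IsAlgClosed k] [IsNoetherianRing A]
    [IsNoetherianRing B] {I : Ideal A} (hI : I ≠ ⊤) {J : Ideal B} (hJ : J ≠ ⊤) {m r : ℕ}
    (h : ¬ symbolicPower (tensorSum k I J) m ≤ tensorSum k I J ^ r) :
    ∃ i j t u, i + j = m ∧ t ≠ 0 ∧ u ≠ 0 ∧ t + u = r + 1 ∧ ¬ symbolicPower I i ≤ I ^ t ∧
      ¬ symbolicPower J j ≤ J ^ u := by
  classical
  obtain ⟨x, hx, hxr⟩ := SetLike.not_le_iff_exists.1 h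
  obtain ⟨t, u, ht, hu, htu, hxtu⟩ : ∃ t u, t ≠ 0 ∧ u ≠ 0 ∧ t + u = r + 1 ∧
      x ∉ tensorSum k (I ^ t) (J ^ u) := by
    by_contra! hc
    exact hxr (mem_tensorSum_pow hc)
  obtain ⟨s, hs, hsx⟩ := mem_symbolicPower_iff.1 hx
  have hmem (i j : ℕ) (hij : i + j ≤ m + 1) :
      x ∈ tensorSum k (symbolicPower I i) (symbolicPower J j) :=
    regular_tensorSum_symbolicPower hs i j x (tensorSum_mono (pow_le_symbolicPower I i)
      (pow_le_symbolicPower J j) (tensorSum_pow_le hij hsx))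
  have hI0 : ¬ symbolicPower I 0 ≤ I ^ t := fun h0 ↦
    hI (top_le_iff.1 ((symbolicPower_zero I).ge.trans (h0.trans (Ideal.pow_le_self ht))))
  have hJ0 : ¬ symbolicPower J 0 ≤ J ^ u := fun h0 ↦
    hJ (top_le_iff.1 ((symbolicPower_zero J).ge.trans (h0.trans (Ideal.pow_le_self hu))))
  -- For the least `i + 1` with `I^(i + 1) ⊆ I ^ t`, the index `i` fails for `I`. Then `m - i` must
  -- fail for `J`, since `x ∈ I^(i + 1) + J^(m - i)`. If there is no such index up to `m`, the pair
  -- `(m, 0)` works because `J^(0)` is the unit ideal.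
  by_cases hm : ∃ i ≤ m, symbolicPower I i ≤ I ^ t
  · obtain ⟨him, hi⟩ := Nat.find_spec hm
    obtain ⟨i, hi'⟩ : ∃ i, Nat.find hm = i + 1 :=
      Nat.exists_eq_succ_of_ne_zero fun h0 ↦ hI0 (h0 ▸ hi)
    rw [hi'] at hi him
    refine ⟨i, m - i, t, u, by omega, ht, hu, htu, fun hle ↦ ?_, fun hle ↦ ?_⟩
    · exact Nat.find_min hm (m := i) (by omega) ⟨by omega, hle⟩
    · exact hxtu (tensorSum_mono hi hle (hmem (i + 1) (m - i) (by omega)))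
  · exact ⟨m, 0, t, u, rfl, ht, hu, htu, fun hle ↦ hm ⟨m, le_rfl, hle⟩, hJ0⟩

theorem resurgence_tensorSum_le [IsAlgClosed k] [IsNoetherianRing A] [IsNoetherianRing B]
    {I : Ideal A} (hI : I ≠ ⊤) {J : Ideal B} (hJ : J ≠ ⊤) :
    resurgence (tensorSum k I J) ≤
      max (max (resurgence I) (resurgence J)) (2 * (resurgence I + resurgence J) / 3) := by
  set M := max (max (resurgence I) (resurgence J)) (2 * (resurgence I + resurgence J) / 3)
  have hMI : resurgence I ≤ M := (le_max_left _ _).trans (le_max_left _ _)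
  have hMJ : resurgence J ≤ M := (le_max_right _ _).trans (le_max_left _ _)
  have hM : 2 * (resurgence I + resurgence J) ≤ M * 3 :=
    (ENNReal.div_le_iff (by simp) (by simp)).1 (le_max_right _ _)
  refine sSup_le ?_
  rintro _ ⟨m, r, hm, hr, hmr, rfl⟩
  obtain ⟨i, j, t, u, rfl, ht, hu, htu, hIt, hJu⟩ :=
    exists_not_le_of_symbolicPower_tensorSum hI hJ hmr
  rw [ENNReal.div_le_iff (by simp; omega) (by simp)]
  rcases eq_or_ne i 0 with rfl | hi
  · rw [zero_add]
    exact (natCast_le_resurgence_mul (by omega) hu hJu).trans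
      (mul_le_mul' hMJ (by exact_mod_cast (by omega : u ≤ r)))
  rcases eq_or_ne j 0 with rfl | hj
  · exact (natCast_le_resurgence_mul hi ht hIt).trans
      (mul_le_mul' hMI (by exact_mod_cast (by omega : t ≤ r)))
  -- Henceforth `t` and `u` denote the excesses over 2, so `r = t + u + 3`: the excesses are bounded
  -- by `M` each, and the remaining `2 * (ρ(I) + ρ(J))` by `M * 3`.
  obtain ⟨t, rfl⟩ := Nat.exists_eq_add_of_le (two_le_of_not_symbolicPower_le_pow hi ht hIt)
  obtain ⟨u, rfl⟩ := Nat.exists_eq_add_of_le (two_le_of_not_symbolicPower_le_pow hj hu hJu)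
  obtain rfl : r = t + u + 3 := by omega
  calc ((i + j : ℕ) : ℝ≥0∞)
      ≤ resurgence I * (2 + t : ℕ) + resurgence J * (2 + u : ℕ) := by
        push_cast
        exact add_le_add (by exact_mod_cast natCast_le_resurgence_mul hi ht hIt)
          (by exact_mod_cast natCast_le_resurgence_mul hj hu hJu)
    _ = resurgence I * t + resurgence J * u + 2 * (resurgence I + resurgence J) := by
        push_cast
        ring
    _ ≤ M * t + M * u + M * 3 := by gcongr
    _ = M * (t + u + 3 : ℕ) := by
        push_cast
        ring

end Resurgence

theorem two_mul_add_div_three_le_max {a b : ℝ≥0∞} (h : 2 * min a b ≤ max a b) :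
    2 * (a + b) / 3 ≤ max a b := by
  rw [ENNReal.div_le_iff (by simp) (by simp), ← max_add_min, mul_add]
  calc 2 * max a b + 2 * min a b ≤ 2 * max a b + max a b := by gcongr
    _ = max a b * 3 := by ring

theorem mainTheorem5 {k A B : Type*} [Field k] [IsAlgClosed k]
    [CommRing A] [IsDomain A] [Algebra k A] [Algebra.FiniteType k A]
    [CommRing B] [IsDomain B] [Algebra k B] [Algebra.FiniteType k B]
    (𝒜 : ℕ → Submodule k A) [GradedAlgebra 𝒜]
    (ℬ : ℕ → Submodule k B) [GradedAlgebra ℬ]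
    (I : Ideal A) (hI : I.IsHomogeneous 𝒜) (hI_ne_bot : I ≠ ⊥) (hI_ne_top : I ≠ ⊤)
    (J : Ideal B) (hJ : J.IsHomogeneous ℬ) (hJ_ne_bot : J ≠ ⊥) (hJ_ne_top : J ≠ ⊤) :
    max (resurgence I) (resurgence J) ≤ resurgence (tensorSum k I J) ∧
    resurgence (tensorSum k I J) ≤
      max (max (resurgence I) (resurgence J)) (2 * (resurgence I + resurgence J) / 3) ∧
    (2 * min (resurgence I) (resurgence J) ≤ max (resurgence I) (resurgence J) →
      resurgence (tensorSum k I J) = max (resurgence I) (resurgence J)) := by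

  have := Algebra.FiniteType.isNoetherianRing k A
  have := Algebra.FiniteType.isNoetherianRing k B
  have : IsNoetherianRing (A ⊗[k] B) := Algebra.FiniteType.isNoetherianRing A _
  have : IsNoetherianRing (B ⊗[k] A) := Algebra.FiniteType.isNoetherianRing B _
  have hlow : max (resurgence I) (resurgence J) ≤ resurgence (tensorSum k I J) :=
    max_le (resurgence_le_resurgence_tensorSum_left I hJ_ne_top)
      ((resurgence_le_resurgence_tensorSum_left J hI_ne_top).trans
        (resurgence_tensorSum_comm_le J I))
  have hup := resurgence_tensorSum_le (k := k) hI_ne_top hJ_ne_top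
  exact ⟨hlow, hup, fun h ↦ le_antisymm
    (hup.trans (max_le le_rfl (two_mul_add_div_three_le_max h))) hlow⟩
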